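/- Formulas are built from propositional letters $p_0,p_1,\dots$ by the Boolean operations $\wedge,\neg$, a unary operation $\mathbf N$ (next) and one binary temporal operation, which is read as $\mathbf U$ (until) in $\mathrm{LTL}$ and as $\mathbf S$ (since) in $\mathrm{LTL}_{Past,m}$; formulas and rules of the two logics are compared by identifying $\mathbf U$ with $\mathbf S$. A model is given by a valuation $V$ assigning to every letter a set of natural numbers. At a state $a\in\mathbb N$, letters and Boolean operations are evaluated as usual, and $\mathbf N\varphi$ is true at $a$ iff $\varphi$ is true at $a+1$. In $\mathrm{LTL}$, $\varphi\,\mathbf U\,\psi$ is true at $a$ iff there is $b\ge a$ such that $\psi$ is true at $b$ and $\varphi$ is true at all $c$ with $a\le c<b$. In $\mathrm{LTL}_{Past,m}$, where $m\in\mathbb N$ is a fixed measure of intransitivity, $\varphi\,\mathbf S\,\psi$ is true at $a$ iff there is $b$ with $a\le b\le a+m$ such that $\psi$ is true at $b$ and $\varphi$ is true at all $c$ with $a\le c<b$. Each logic is the set of formulas true at all states of all models under its reading. An inference rule $\varphi_1,\dots,\varphi_l/\psi$ (with $l\ge 1$) is admissible in a logic $L$ if every substitution of formulas for letters that turns all of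 $\varphi_1,\dots,\varphi_l$ into members of $L$ also turns $\psi$ into a member of $L$. It is not passive in $L$ if at least one substitution turns all of $\varphi_1,\dots,\varphi_l$ into members of $L$, i.e. its premises are unifiable in $L$. Theorem. For every $m\in\mathbb N$ there exist inference rules that are not passive (their premises are unifiable both in $\mathrm{LTL}_{Past,m}$ and in $\mathrm{LTL}$), that are admissible in $\mathrm{LTL}_{Past,m}$, and that are not admissible in $\mathrm{LTL}$. Moreover, there are rules admissible in $\mathrm{LTL}$ but not in $\mathrm{LTL}_{Past,m}$. Hence $\mathrm{LTL}$ and $\mathrm{LTL}_{Past,m}$ differ with respect to admissible inference rules: neither of the two sets of admissible rules is contained in the other. -/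

import Mathlib

namespace TemporalLogic

/-- Formulas over the propositional letters `p 0, p 1, ...`, built with Boolean operations, the
unary `next` and one binary temporal operation `till`. The operation `till` is "until" when formulas
are read in linear temporal logic and "since" when they are read in the past-directed
non-transitive logics: the two languages differ only in the name of this symbol. -/
inductive Formula : Type
  | letter (p : ℕ) : Formula
  | and (φ ψ : Formula) : Formula
  | neg (φ : Formula) : Formula
  | next (φ : Formula) : Formula
  | till (φ ψ : Formula) : Formula

namespace Formula

/-- Simultaneous substitution of formulas for letters. -/
def subst (σ : ℕ → Formula) : Formula → Formula
  | letter p => σ p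
  | and φ ψ => and (φ.subst σ) (ψ.subst σ)
  | neg φ => neg (φ.subst σ)
  | next φ => next (φ.subst σ)
  | till φ ψ => till (φ.subst σ) (ψ.subst σ)

end Formula

/-- The relation `a Next b`: `b` is the number next to `a`. -/
def Next (a b : ℕ) : Prop := b = a + 1

/-- Truth at a state of a model whose states are the natural numbers. Here `acc a b` says that the
state `b` may be inspected from `a` when a binary temporal operation is evaluated at `a`, and
`V p` is the set of states at which the letter `p` is true. -/
def Sat (acc : ℕ → ℕ → Prop) (V : ℕ → Set ℕ) : ℕ → Formula → Prop
  | a, .letter p => a ∈ V p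
  | a, .and φ ψ => Sat acc V a φ ∧ Sat acc V a ψ
  | a, .neg φ => ¬ Sat acc V a φ
  | a, .next φ => ∀ b, Next a b → Sat acc V b φ
  | a, .till φ ψ =>
      ∃ b, acc a b ∧ Sat acc V b ψ ∧ ∀ c, a ≤ c → c < b → Sat acc V c φ

/-- The relation `x R_i y` of the frame with measure of intransitivity `m`: the order `x ≥ y`
restricted to the interval `[i, i + m]`. -/
def R (m i x y : ℕ) : Prop :=
  x ∈ Set.Icc i (i + m) ∧ y ∈ Set.Icc i (i + m) ∧ x ≥ y

/-- The linear temporal logic `LTL` (with until and next): the formulas true at every state of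
every model on the natural numbers with the standard order. -/
def LTL : Set Formula :=
  {φ | ∀ (V : ℕ → Set ℕ) (a : ℕ), Sat (fun a b => a ≤ b) V a φ}

/-- The logic `LTL_{Past,m}`: the formulas true at every state of every model on the natural
numbers with measure of intransitivity `m`, where "since" is the weak bounded one
(the witness `b` has to satisfy `b R_a a`). -/
def LTLPast (m : ℕ) : Set Formula :=
  {φ | ∀ (V : ℕ → Set ℕ) (a : ℕ), Sat (fun a b => R m a b a) V a φ}

/-- Inference rules `φ₁, ..., φ_l / ψ`, with `l ≥ 1`. -/
structure Rule where
  premises : List Formula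
  premises_ne_nil : premises ≠ []
  conclusion : Formula

/-- `σ` is a unifier of the premises in `L`: it makes all of them theorems of `L`. -/
def Rule.Unifies (r : Rule) (L : Set Formula) (σ : ℕ → Formula) : Prop :=
  ∀ φ ∈ r.premises, φ.subst σ ∈ L

/-- A rule is not passive in `L` if its premises are (jointly) unifiable in `L`. -/
def Rule.NotPassive (r : Rule) (L : Set Formula) : Prop :=
  ∃ σ : ℕ → Formula, r.Unifies L σ

/-- A rule is admissible in `L` if each instance that turns all premises into theorems of `L`
turns the conclusion into a theorem of `L`. -/
def Rule.Admissible (r : Rule) (L : Set Formula) : Prop :=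
  ∀ σ : ℕ → Formula, r.Unifies L σ → r.conclusion.subst σ ∈ L

/-- The set of all rules admissible in `L`. -/
def admissibleRules (L : Set Formula) : Set Rule :=
  {r | r.Admissible L}

end TemporalLogic

namespace TemporalLogic

namespace Formula

/-! The temporal operation of `LTLPast m` sees only the states `a, ..., a + m`, that of `LTL` sees
the whole future, and iterated `next` measures distance in both. "What eventually holds, holds
within `m` steps" is thus sound at every state of `LTLPast m`, and "what holds `m + 1` steps ahead
holds eventually" is sound at every state of `LTL`. Soundness at each state gives admissibility
without any study of unifiers. Each refutation in the other logic needs one substitution and one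
model. -/

/-- Implication. -/
def imp (φ ψ : Formula) : Formula := neg (and φ (neg ψ))

/-- Disjunction. -/
def or (φ ψ : Formula) : Formula := neg (and (neg φ) (neg ψ))

/-- `φ` holds at some accessible state. -/
def eventually (φ : Formula) : Formula := till (imp φ φ) φ

/-- The `n`-fold iteration of `next`. -/
def nextIter : ℕ → Formula → Formula
  | 0, φ => φ
  | n + 1, φ => next (nextIter n φ)

/-- `φ` holds at one of the first `n + 1` states, the present one included. -/
def within : ℕ → Formula → Formula
  | 0, φ => φ
  | n + 1, φ => or φ (next (within n φ))

theorem subst_nextIter (σ : ℕ → Formula) (n : ℕ) (φ : Formula) :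
    (nextIter n φ).subst σ = nextIter n (φ.subst σ) := by
  induction n with
  | zero => rfl
  | succ n ih => simp [nextIter, subst, ih]

theorem subst_within (σ : ℕ → Formula) (n : ℕ) (φ : Formula) :
    (within n φ).subst σ = within n (φ.subst σ) := by
  induction n with
  | zero => rfl
  | succ n ih => simp [within, or, subst, ih]

theorem subst_imp (σ : ℕ → Formula) (φ ψ : Formula) :
    (imp φ ψ).subst σ = imp (φ.subst σ) (ψ.subst σ) := rfl

theorem subst_eventually (σ : ℕ → Formula) (φ : Formula) :
    (eventually φ).subst σ = eventually (φ.subst σ) := rfl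

end Formula

open Formula

section Sat

variable {acc : ℕ → ℕ → Prop} {V : ℕ → Set ℕ} {a : ℕ} {φ ψ : Formula}

theorem sat_imp : Sat acc V a (imp φ ψ) ↔ (Sat acc V a φ → Sat acc V a ψ) := by
  simp [imp, Sat]

theorem sat_or : Sat acc V a (or φ ψ) ↔ (Sat acc V a φ ∨ Sat acc V a ψ) := by
  simp only [Formula.or, Sat]
  tauto

theorem sat_next : Sat acc V a (next φ) ↔ Sat acc V (a + 1) φ := by
  simp [Sat, Next]

theorem sat_eventually : Sat acc V a (eventually φ) ↔ ∃ b, acc a b ∧ Sat acc V b φ := by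
  simp [eventually, Sat, sat_imp]

theorem sat_nextIter {n : ℕ} : Sat acc V a (nextIter n φ) ↔ Sat acc V (a + n) φ := by
  induction n generalizing a with
  | zero => rfl
  | succ n ih => rw [nextIter, sat_next, ih, add_assoc, add_comm 1 n]

theorem sat_within {n : ℕ} :
    Sat acc V a (within n φ) ↔ ∃ b, a ≤ b ∧ b ≤ a + n ∧ Sat acc V b φ := by
  induction n generalizing a with
  | zero =>
    refine ⟨fun h => ⟨a, le_rfl, le_rfl, h⟩, ?_⟩
    rintro ⟨b, hab, hba, h⟩
    obtain rfl : a = b := le_antisymm hab hba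
    exact h
  | succ n ih =>
    rw [within, sat_or, sat_next, ih]
    constructor
    · rintro (h | ⟨b, hab, hba, h⟩)
      · exact ⟨a, le_rfl, by omega, h⟩
      · exact ⟨b, by omega, by omega, h⟩
    · rintro ⟨b, hab, hba, h⟩
      rcases hab.eq_or_lt with rfl | hlt
      · exact Or.inl h
      · exact Or.inr ⟨b, by omega, by omega, h⟩

end Sat

theorem R_present_iff {m a b : ℕ} : R m a b a ↔ a ≤ b ∧ b ≤ a + m := by
  simp only [R, Set.mem_Icc]
  omega

/-- From "eventually `p₀`" infer that `p₀` holds within `m` steps. -/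
def withinRule (m : ℕ) : Rule where
  premises := [eventually (letter 0)]
  premises_ne_nil := by simp
  conclusion := within m (letter 0)

/-- From `p₁ → N ⋯ N p₀`, with `m + 1` occurrences of `N`, infer that `p₁` implies
"eventually `p₀`". -/
def farRule (m : ℕ) : Rule where
  premises := [imp (letter 1) (nextIter (m + 1) (letter 0))]
  premises_ne_nil := by simp
  conclusion := imp (letter 1) (eventually (letter 0))

theorem withinRule_unifies {m : ℕ} {L : Set Formula} {σ : ℕ → Formula} :
    (withinRule m).Unifies L σ ↔ eventually (σ 0) ∈ L := by
  simp [withinRule, Rule.Unifies, subst_eventually, subst]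

theorem withinRule_admissible {m : ℕ} {L : Set Formula} :
    (withinRule m).Admissible L ↔
      ∀ σ : ℕ → Formula, eventually (σ 0) ∈ L → within m (σ 0) ∈ L := by
  simp only [Rule.Admissible, withinRule_unifies]
  simp [withinRule, subst_within, subst]

theorem farRule_admissible {m : ℕ} {L : Set Formula} :
    (farRule m).Admissible L ↔
      ∀ σ : ℕ → Formula, imp (σ 1) (nextIter (m + 1) (σ 0)) ∈ L →
        imp (σ 1) (eventually (σ 0)) ∈ L := by
  simp [Rule.Admissible, Rule.Unifies, farRule, subst_imp, subst_eventually, subst_nextIter, subst]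

theorem withinRule_notPassive_LTL (m : ℕ) : (withinRule m).NotPassive LTL := by
  -- The language has no constant for truth, so a tautology replaces it; the present state is then a
  -- witness.
  refine ⟨fun _ => imp (letter 0) (letter 0), withinRule_unifies.2 fun V a => ?_⟩
  exact sat_eventually.2 ⟨a, le_rfl, sat_imp.2 id⟩

theorem withinRule_notPassive_LTLPast (m : ℕ) : (withinRule m).NotPassive (LTLPast m) := by
  refine ⟨fun _ => imp (letter 0) (letter 0), withinRule_unifies.2 fun V a => ?_⟩
  exact sat_eventually.2 ⟨a, R_present_iff.2 ⟨le_rfl, Nat.le_add_right a m⟩, sat_imp.2 id⟩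

theorem withinRule_admissible_LTLPast (m : ℕ) : (withinRule m).Admissible (LTLPast m) := by
  refine withinRule_admissible.2 fun σ h V a => ?_
  obtain ⟨b, hb, hσ⟩ := sat_eventually.1 (h V a)
  exact sat_within.2 ⟨b, (R_present_iff.1 hb).1, (R_present_iff.1 hb).2, hσ⟩

/-- The formula "`p₀`, or never `p₀`" is bound to become true in every model of `LTL`, but it may
take longer than `m` steps to do so. -/
theorem withinRule_not_admissible_LTL (m : ℕ) : ¬ (withinRule m).Admissible LTL := by
  intro h
  let χ : Formula := or (letter 0) (neg (eventually (letter 0)))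
  have hχ : eventually χ ∈ LTL := by
    intro V a
    rw [sat_eventually]
    by_cases hp : Sat (fun a b => a ≤ b) V a (eventually (letter 0))
    · obtain ⟨b, hab, hb⟩ := sat_eventually.1 hp
      exact ⟨b, hab, sat_or.2 (Or.inl hb)⟩
    · exact ⟨a, le_rfl, sat_or.2 (Or.inr hp)⟩
  -- With `p₀` true only at `m + 1`, at each of the states `0, ..., m` it is false but still to
  -- come, so both disjuncts of `χ` fail there.
  obtain ⟨b, -, hb, hσ⟩ :=
    sat_within.1 (withinRule_admissible.1 h (fun _ => χ) hχ (fun _ => {m + 1}) 0)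
  rcases sat_or.1 hσ with hp | hn
  · have : b = m + 1 := hp
    omega
  · exact hn (sat_eventually.2 ⟨m + 1, show b ≤ m + 1 by omega, rfl⟩)

theorem farRule_admissible_LTL (m : ℕ) : (farRule m).Admissible LTL := by
  refine farRule_admissible.2 fun σ h V a => sat_imp.2 fun hq => ?_
  exact sat_eventually.2 ⟨a + (m + 1), Nat.le_add_right _ _, sat_nextIter.1 (sat_imp.1 (h V a) hq)⟩

theorem farRule_not_admissible_LTLPast (m : ℕ) : ¬ (farRule m).Admissible (LTLPast m) := by
  intro h
  -- Replacing `p₁` by the consequent makes the premise trivial. The antecedent `p₁` is essential: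
  -- if `nextIter (m + 1) φ` alone is a theorem, shifting models shows that `φ` is one too.
  let σ : ℕ → Formula := fun n => if n = 0 then letter 0 else nextIter (m + 1) (letter 0)
  have hσ : imp (σ 1) (nextIter (m + 1) (σ 0)) ∈ LTLPast m := fun V a => sat_imp.2 id
  have hc := sat_imp.1 (farRule_admissible.1 h σ hσ (fun _ => {m + 1}) 0)
  -- From state `0`, the only state where `p₀` holds is one step out of reach.
  obtain ⟨b, hb, hp⟩ := sat_eventually.1 (hc (sat_nextIter.2 (Nat.zero_add (m + 1))))
  have hbm : b = m + 1 := hp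
  have := (R_present_iff.1 hb).2
  omega

end TemporalLogic

theorem mainTheorem4 (m : ℕ) :
    (∃ r : TemporalLogic.Rule,
      r.NotPassive (TemporalLogic.LTLPast m) ∧ r.NotPassive TemporalLogic.LTL ∧
      r.Admissible (TemporalLogic.LTLPast m) ∧ ¬ r.Admissible TemporalLogic.LTL) ∧
    ¬ TemporalLogic.admissibleRules (TemporalLogic.LTLPast m) ⊆
        TemporalLogic.admissibleRules TemporalLogic.LTL ∧
    ¬ TemporalLogic.admissibleRules TemporalLogic.LTL ⊆
        TemporalLogic.admissibleRules (TemporalLogic.LTLPast m) :=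
  ⟨⟨TemporalLogic.withinRule m,
      TemporalLogic.withinRule_notPassive_LTLPast m,
      TemporalLogic.withinRule_notPassive_LTL m,
      TemporalLogic.withinRule_admissible_LTLPast m,
      TemporalLogic.withinRule_not_admissible_LTL m⟩,
    fun h => TemporalLogic.withinRule_not_admissible_LTL m
      (h (TemporalLogic.withinRule_admissible_LTLPast m)),
    fun h => TemporalLogic.farRule_not_admissible_LTLPast m
      (h (TemporalLogic.farRule_admissible_LTL m))⟩
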